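/- **Setting.** Fix a period $\ell>0$, a core radius $r_0\in(0,\ell/2)$, Lamé coefficients $\mu,\lambda\in\mathbb R$ with $\mu>0$ and $\mu+\lambda>0$, a surface tension $\gamma>0$, a mismatch $e_0\neq 0$, Burgers vectors $\mathbf b_1,\dots,\mathbf b_k\in\mathbb R^2$ ($k\ge 0$), and a nonnegative radially symmetric $\varrho\in C_c^\infty(B_1(0))$ with $\int_{\mathbb R^2}\varrho\,dz=1$; put $\varrho_{r_0}(z):=r_0^{-2}\varrho(z/r_0)$. *Profiles.* $AP(0,\ell)$ is the set of lower semicontinuous $\ell$-periodic functions $h:\mathbb R\to[0,\infty)$ with finite pointwise total variation on $(0,\ell)$. Let $h^+(x)$ and $h^-(x)$ be the maximum and the minimum of the one-sided limits $h(x+)$, $h(x-)$, and let $$\Omega_h:=\{(x,y):0\le x<\ell,\ 0<y<h(x)\},\qquad \Omega_h^\#:=\{(x,y):x\in\mathbb R,\ 0<y<h(x)\},$$ $$\Gamma_h:=\{(x,y):x\in[0,\ell),\ h^-(x)\le y\le h^+(x)\},\qquad \Sigma_h:=\{(x,y):x\in[0,\ell),\ h(x)<h^-(x),\ h(x)\le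 y\le h^-(x)\}.$$ *Dislocations.* $\mathcal M_{dis}(\Omega_h;\mathbf B)$ is the set of $\mathbb R^2$-valued measures $\sigma=\sum_{i=1}^k\mathbf b_i\delta^\#_{z_i}$, where $\delta^\#_z:=\sum_{m\in\mathbb Z}\delta_{z+m\ell\mathbf e_1}$ and the (not necessarily distinct) centers satisfy $z_i\in\Omega_h$ and $B_{r_0}(z_i)\subset\Omega_h^\#$. *Admissible configurations.* For a matrix field $H$, $\operatorname{curl}H:=(\partial_xH_{12}-\partial_yH_{11},\ \partial_xH_{22}-\partial_yH_{21})$ in the sense of distributions, and $H^\#$ is the $\ell$-periodic extension of $H$ in $x$. $X(e_0;\mathbf B)$ is the set of triples $(h,\sigma,H)$ such that $h\in AP(0,\ell)$, $\sigma\in\mathcal M_{dis}(\Omega_h;\mathbf B)$, $H:\Omega_h\to\mathbb R^{2\times2}$ with $H^\#$ square integrable on the compact subsets of $\{(x,y):0\le y<h(x)\}$, $\operatorname{curl}H\in L^2(\Omega_h;\mathbb R^2)$, $\operatorname{curl}H^\#\in L^2_{loc}(\Omega_h^\#;\mathbb R^2)$, $\operatorname{curl}H^\#=\sigma*\varrho_{r_0}$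 in $\Omega_h^\#$, and $H[\mathbf e_1]=e_0\mathbf e_1$ on $\{y=0\}$ in the sense of the tangential trace, that is, for every $\varphi\in C_c^\infty(\{(x,y):y<h(x)\})$ and $i=1,2$, $$\int_{\Omega_h^\#}\bigl(H^\#_{i1}\partial_y\varphi-H^\#_{i2}\partial_x\varphi\bigr)\,dz+\int_{\mathbb R}e_0(\mathbf e_1)_i\,\varphi(x,0)\,dx=\int_{\Omega_h^\#}(\sigma*\varrho_{r_0})_i\,\varphi\,dz .$$ *Energy.* With $W(E):=\mu|E|^2+\frac{\lambda}{2}(\operatorname{tr}E)^2$ and $H_{sym}:=\frac12(H+H^T)$, let $$F(h,\sigma,H):=\int_{\Omega_h}W(H_{sym})\,dz+\gamma\mathcal H^1(\Gamma_h)+2\gamma\mathcal H^1(\Sigma_h)\in[0,\infty].$$ Let $v_0(x,y):=\bigl(x,\frac{-\lambda y}{2\mu+\lambda}\bigr)$ and $W_0:=W((Dv_0)_{sym})$. **Theorem.** Let $d>0$ and let $(\bar h,\bar\sigma,\bar H)$ be a minimizer of $$\min\{F(h,\sigma,H):\ (h,\sigma,H)\in X(e_0;\mathbf B),\ |\Omega_h|=d\}.$$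 Then, for every $\Lambda>e_0^2W_0$, $(\bar h,\bar\sigma,\bar H)$ is also a minimizer of $$\min\bigl\{F(h,\sigma,H)+\Lambda\,(d-|\Omega_h|):\ (h,\sigma,H)\in X(e_0;\mathbf B),\ |\Omega_h|\le d\bigr\}.$$ -/

import Mathlib

open MeasureTheory Set
open scoped CompactlySupported ContDiff

noncomputable section

namespace EpitaxialFilm

/-- The plane `ℝ²` with its Euclidean norm; `z 0` is the abscissa `x`, `z 1` the ordinate `y`. -/
abbrev Plane := EuclideanSpace ℝ (Fin 2)

/-- `2 × 2` real matrices. -/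
abbrev Mat := Matrix (Fin 2) (Fin 2) ℝ

/-- The `i`-th vector of the canonical basis (`basisVec 0` is `𝐞₁`, `basisVec 1` is `𝐞₂`). -/
def basisVec (i : Fin 2) : Plane := EuclideanSpace.single i 1

/-- The fixed data of the model, with the standing assumptions on them. -/
structure FilmData where
  /-- the period `ℓ` -/
  ell : ℝ
  /-- the core radius `r₀` of the dislocations -/
  r0 : ℝ
  /-- first Lamé coefficient `μ` -/
  mu : ℝ
  /-- second Lamé coefficient `λ` -/
  lam : ℝ
  /-- the surface tension `γ` -/
  gam : ℝ
  /-- the lattice mismatch `e₀` -/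
  e0 : ℝ
  /-- the mollifier `ϱ` -/
  rho : Plane → ℝ
  ell_pos : 0 < ell
  r0_pos : 0 < r0
  r0_lt : r0 < ell / 2
  mu_pos : 0 < mu
  mu_add_lam_pos : 0 < mu + lam
  gam_pos : 0 < gam
  e0_ne : e0 ≠ 0
  rho_smooth : ContDiff ℝ ∞ rho
  rho_compact : HasCompactSupport rho
  rho_support : tsupport rho ⊆ Metric.ball 0 1
  rho_nonneg : ∀ z, 0 ≤ rho z
  rho_radial : ∀ z w, ‖z‖ = ‖w‖ → rho z = rho w
  rho_integral : ∫ z, rho z = 1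

/-! ### Profiles -/

/-- Admissible profiles `AP(0,ℓ)`. The variation is the pointwise one on the open interval. -/
structure IsProfile (ell : ℝ) (h : ℝ → ℝ) : Prop where
  nonneg : ∀ x, 0 ≤ h x
  lsc : LowerSemicontinuous h
  periodic : Function.Periodic h ell
  bddVar : BoundedVariationOn h (Ioo 0 ell)

/-- `h⁺`, the larger of the two one-sided limits. -/
def upperLim (h : ℝ → ℝ) (x : ℝ) : ℝ := max (Function.rightLim h x) (Function.leftLim h x)

/-- `h⁻`, the smaller of the two one-sided limits. -/
def lowerLim (h : ℝ → ℝ) (x : ℝ) : ℝ := min (Function.rightLim h x) (Function.leftLim h x)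

/-- The film `Ω_h` over one period. -/
def film (ell : ℝ) (h : ℝ → ℝ) : Set Plane := {z | z 0 ∈ Ico 0 ell ∧ 0 < z 1 ∧ z 1 < h (z 0)}

/-- The periodic film `Ω_h^#`. -/
def filmPer (h : ℝ → ℝ) : Set Plane := {z | 0 < z 1 ∧ z 1 < h (z 0)}

/-- The periodic film together with the part of the interface `{y = 0}` lying below it. -/
def filmBase (h : ℝ → ℝ) : Set Plane := {z | 0 ≤ z 1 ∧ z 1 < h (z 0)}

/-- Everything strictly below the profile, substrate included. -/
def subgraph (h : ℝ → ℝ) : Set Plane := {z | z 1 < h (z 0)}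

/-- `Γ_h`. -/
def graphSet (ell : ℝ) (h : ℝ → ℝ) : Set Plane :=
  {z | z 0 ∈ Ico 0 ell ∧ lowerLim h (z 0) ≤ z 1 ∧ z 1 ≤ upperLim h (z 0)}

/-- The vertical cracks `Σ_h`. -/
def crackSet (ell : ℝ) (h : ℝ → ℝ) : Set Plane :=
  {z | z 0 ∈ Ico 0 ell ∧ h (z 0) < lowerLim h (z 0) ∧ h (z 0) ≤ z 1 ∧ z 1 ≤ lowerLim h (z 0)}

/-! ### Elastic energy density -/

/-- The symmetric part of a matrix. -/
def symPart (A : Mat) : Mat := (1 / 2 : ℝ) • (A + A.transpose)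

/-- `W(E) = μ |E|² + (λ/2) (tr E)²`, with the Frobenius norm. -/
def elasticDensity (mu lam : ℝ) (E : Mat) : ℝ :=
  mu * ∑ i, ∑ j, E i j ^ 2 + lam / 2 * E.trace ^ 2

/-- The Jacobian matrix `Du`. -/
def jacobian (u : Plane → Plane) (z : Plane) : Mat :=
  Matrix.of fun i j => fderiv ℝ u z (basisVec j) i

/-- The flat elastic equilibrium `v₀(x,y) = (x, -λ y / (2μ+λ))`. -/
def flatEquilibrium (mu lam : ℝ) (z : Plane) : Plane := !₂[z 0, -lam * z 1 / (2 * mu + lam)]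

/-- `W₀ = W(E(v₀))`; as `v₀` is linear, its strain is constant, and it is read off at the origin. -/
def FilmData.W0 (P : FilmData) : ℝ :=
  elasticDensity P.mu P.lam (symPart (jacobian (flatEquilibrium P.mu P.lam) 0))

/-! ### Dislocation measures -/

/-- `ℝ²`-valued Radon measures on the plane, seen (Riesz) as linear functionals on the continuous
compactly supported functions. -/
abbrev VecMeasure := C_c(Plane, ℝ) →ₗ[ℝ] Plane

/-- A compactly supported function meets only finitely many points of a periodic row. -/
theorem finite_row {ell : ℝ} (hell : 0 < ell) (z : Plane) (φ : C_c(Plane, ℝ)) :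
    (Function.support fun m : ℤ => φ (z + ((m : ℝ) * ell) • basisVec 0)).Finite := by
  obtain ⟨R, hR⟩ := (show IsCompact (tsupport φ) from φ.hasCompactSupport).isBounded.exists_norm_le
  refine (Set.finite_Icc (-⌈(R + ‖z‖) / ell⌉) ⌈(R + ‖z‖) / ell⌉).subset ?_
  intro m hm
  have h1 := hR _ (subset_tsupport _ hm)
  have h2 : ‖((m : ℝ) * ell) • basisVec 0‖ = |(m : ℝ)| * ell := by
    simp [basisVec, norm_smul, abs_of_pos hell]
  have h3 : |(m : ℝ)| * ell ≤ R + ‖z‖ := by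
    rw [← h2]
    calc _ = ‖(z + ((m : ℝ) * ell) • basisVec 0) - z‖ := by congr 1; abel
      _ ≤ _ := (norm_sub_le _ _).trans (by linarith)
  have h4 : |(m : ℝ)| ≤ ⌈(R + ‖z‖) / ell⌉ := ((le_div_iff₀ hell).2 h3).trans (Int.le_ceil _)
  have h5 := abs_le.1 h4
  exact ⟨by exact_mod_cast h5.1, by exact_mod_cast h5.2⟩

/-- The periodic Dirac mass `δ_z^# = ∑_{m ∈ ℤ} δ_{z + m ℓ 𝐞₁}`. -/
def periodicDirac {ell : ℝ} (hell : 0 < ell) (z : Plane) : C_c(Plane, ℝ) →ₗ[ℝ] ℝ where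
  toFun φ := ∑ᶠ m : ℤ, φ (z + ((m : ℝ) * ell) • basisVec 0)
  map_add' φ ψ := finsum_add_distrib (finite_row hell z φ) (finite_row hell z ψ)
  map_smul' c φ := (smul_finsum c fun m : ℤ => φ (z + ((m : ℝ) * ell) • basisVec 0)).symm

/-- The measure `∑ᵢ bᵢ δ_{zᵢ}^#`. -/
def dislocationMeasure {ell : ℝ} (hell : 0 < ell) {k : ℕ} (b z : Fin k → Plane) : VecMeasure :=
  ∑ i, (periodicDirac hell (z i)).smulRight (b i)

/-- `M_dis(Ω_h; 𝐁)`: centres in `Ω_h`, possibly repeated, with cores contained in `Ω_h^#`. -/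
def dislocationMeasures (P : FilmData) (h : ℝ → ℝ) {k : ℕ} (b : Fin k → Plane) :
    Set VecMeasure :=
  {σ | ∃ z : Fin k → Plane,
    (∀ i, z i ∈ film P.ell h ∧ Metric.ball (z i) P.r0 ⊆ filmPer h) ∧
    σ = dislocationMeasure P.ell_pos b z}

/-- The rescaled mollifier `ϱ_{r₀}(z) = r₀⁻² ϱ(z / r₀)`. -/
def FilmData.mollifier (P : FilmData) (z : Plane) : ℝ := (P.r0 ^ 2)⁻¹ * P.rho (P.r0⁻¹ • z)

/-- The function `w ↦ ϱ_{r₀}(z - w)`, as a test function. -/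
def FilmData.reflectedMollifier (P : FilmData) (z : Plane) : C_c(Plane, ℝ) where
  toFun w := P.mollifier (z - w)
  continuous_toFun := by
    have := P.rho_smooth.continuous
    unfold FilmData.mollifier
    fun_prop
  hasCompactSupport' := by
    have h1 : HasCompactSupport fun w : Plane => P.rho (P.r0⁻¹ • w) :=
      P.rho_compact.comp_homeomorph (Homeomorph.smulOfNeZero _ (inv_ne_zero P.r0_pos.ne'))
    have h2 : HasCompactSupport fun w : Plane => P.rho (P.r0⁻¹ • (z - w)) :=
      h1.comp_homeomorph (Homeomorph.subLeft z)
    exact h2.mul_left (f := fun _ => (P.r0 ^ 2)⁻¹)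

/-- The convolution `σ * ϱ_{r₀}`, that is `z ↦ ∫ ϱ_{r₀}(z - w) dσ(w)`. -/
def convMollifier (P : FilmData) (σ : VecMeasure) (z : Plane) : Plane :=
  σ (P.reflectedMollifier z)

/-! ### Strain fields -/

/-- The periodic extension `H^#` of a field given over `0 ≤ x < ℓ`. -/
def periodicExt (ell : ℝ) (H : Plane → Mat) (z : Plane) : Mat :=
  H (z - ((⌊z 0 / ell⌋ : ℝ) * ell) • basisVec 0)

/-- Smooth functions with compact support contained in `U`. -/
def IsTest (U : Set Plane) (φ : Plane → ℝ) : Prop :=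
  ContDiff ℝ ∞ φ ∧ HasCompactSupport φ ∧ tsupport φ ⊆ U

/-- The partial derivative of `φ` in the direction of the `j`-th axis. -/
def pderiv (j : Fin 2) (φ : Plane → ℝ) (z : Plane) : ℝ := fderiv ℝ φ z (basisVec j)

/-- `curl H = f` in the open set `U`, in the sense of distributions, where
`(curl H)ᵢ = ∂ₓ Hᵢ₂ - ∂_y Hᵢ₁`. -/
def HasWeakCurl (U : Set Plane) (H : Plane → Mat) (f : Plane → Plane) : Prop :=
  ∀ φ, IsTest U φ → ∀ i : Fin 2,
    ∫ z in U, (H z i 0 * pderiv 1 φ z - H z i 1 * pderiv 0 φ z) = ∫ z in U, f z i * φ z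

/-- The field `H` on `Ω_h^#`, whose curl is `f`, has tangential trace `H[𝐞₁] = v` on `{y = 0}`:
this is Green's formula, for test functions that vanish near the profile but need not vanish
on `{y = 0}`. -/
def HasTangentialTrace (h : ℝ → ℝ) (H : Plane → Mat) (f : Plane → Plane) (v : Plane) : Prop :=
  ∀ φ, IsTest (subgraph h) φ → ∀ i : Fin 2,
    (∫ z in filmPer h, (H z i 0 * pderiv 1 φ z - H z i 1 * pderiv 0 φ z))
      + ∫ x : ℝ, v i * φ !₂[x, 0] = ∫ z in filmPer h, f z i * φ z

/-- The space `𝐇_#(curl; Ω_h; 𝕄^{2×2})`. Local square integrability of the field is understood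
up to the interface `{y = 0}` and, periodically, up to the lateral sides (but not up to the
profile), so that a tangential trace on `{y = 0}` makes sense. -/
def MemHcurl (ell : ℝ) (h : ℝ → ℝ) (H : Plane → Mat) : Prop :=
  (∀ K, IsCompact K → K ⊆ filmBase h → ∀ i j,
    MemLp (fun z => periodicExt ell H z i j) 2 (volume.restrict K)) ∧
  ∃ f : Plane → Plane, HasWeakCurl (filmPer h) (periodicExt ell H) f ∧
    MemLp f 2 (volume.restrict (film ell h)) ∧
    ∀ K, IsCompact K → K ⊆ filmPer h → MemLp f 2 (volume.restrict K)

/-! ### Admissible configurations and energy -/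

/-- Triples `(h, σ, H)`; only the values of `H` on `Ω_h` matter. -/
structure Config where
  /-- the profile -/
  h : ℝ → ℝ
  /-- the dislocation measure -/
  σ : VecMeasure
  /-- the strain field -/
  H : Plane → Mat

/-- The class `X(e₀; 𝐁)`. -/
structure IsAdmissible (P : FilmData) {k : ℕ} (b : Fin k → Plane) (c : Config) : Prop where
  profile : IsProfile P.ell c.h
  measure : c.σ ∈ dislocationMeasures P c.h b
  memHcurl : MemHcurl P.ell c.h c.H
  curl_eq : HasWeakCurl (filmPer c.h) (periodicExt P.ell c.H) (convMollifier P c.σ)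
  trace_eq : HasTangentialTrace c.h (periodicExt P.ell c.H) (convMollifier P c.σ)
    (P.e0 • basisVec 0)

/-- The total energy `F(h, σ, H)`, with values in `[0, ∞]`. -/
def energy (P : FilmData) (c : Config) : ENNReal :=
  (∫⁻ z in film P.ell c.h, ENNReal.ofReal (elasticDensity P.mu P.lam (symPart (c.H z))))
    + ENNReal.ofReal P.gam * Measure.hausdorffMeasure 1 (graphSet P.ell c.h)
    + 2 * ENNReal.ofReal P.gam * Measure.hausdorffMeasure 1 (crackSet P.ell c.h)

/-- Admissible configurations with `|Ω_h| = d`. -/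
def classEq (P : FilmData) {k : ℕ} (b : Fin k → Plane) (d : ℝ) : Set Config :=
  {c | IsAdmissible P b c ∧ volume (film P.ell c.h) = ENNReal.ofReal d}

/-- Admissible configurations with `|Ω_h| ≤ d`. -/
def classLe (P : FilmData) {k : ℕ} (b : Fin k → Plane) (d : ℝ) : Set Config :=
  {c | IsAdmissible P b c ∧ volume (film P.ell c.h) ≤ ENNReal.ofReal d}

/-- The penalized energy `F(h, σ, H) + Λ (d - |Ω_h|)`, considered on `{|Ω_h| ≤ d}`. -/
def penalizedEnergy (P : FilmData) (Λ d : ℝ) (c : Config) : ENNReal :=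
  energy P c + ENNReal.ofReal (Λ * (d - volume.real (film P.ell c.h)))

/-- `c` is a minimizer of `f` over the class `S`. -/
def IsMinimizer (S : Set Config) (f : Config → ENNReal) (c : Config) : Prop :=
  c ∈ S ∧ ∀ c' ∈ S, f c ≤ f c'

end EpitaxialFilm

end

noncomputable section

namespace EpitaxialFilm

/-! A competitor `c'` with too little area `v` is lifted by `t = (d - v) / ℓ`, and the gap `0 < y <
t` is filled with the constant strain `e₀ Dv₀`; the dislocation centres move up with the film. The
result has area `d`, so it can be compared with the minimizer `c`. Translation changes neither the
old elastic energy nor the lengths, so the only cost is that of the slab, `e₀² W₀ (d - v)`. Hence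
`F(c) ≤ F(c') + e₀² W₀ (d - v) ≤ F(c') + Λ (d - v)`, while the penalty vanishes at `c`. The point to
check is that the lifted triple is admissible (`IsAdmissible.exists_raise`). The first column of `e₀
Dv₀` is `e₀ 𝐞₁`, which is the trace of the old field at its base. The tangential component therefore
does not jump across `y = t`, no curl concentrates there, and the trace condition moves down to `y =
0` (`HasTangentialTrace.raise`). The energy balance is `film_raise_energy`. -/

/-- The vertical vector of height `t`. -/
def vert (t : ℝ) : Plane := t • basisVec 1

@[simp] theorem vert_zero_coord (t : ℝ) : vert t 0 = 0 := by simp [vert, basisVec]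

@[simp] theorem vert_one_coord (t : ℝ) : vert t 1 = t := by simp [vert, basisVec]

/-- The horizontal strip `0 < y < t`. -/
def strip (t : ℝ) : Set Plane := {z | 0 < z 1 ∧ z 1 < t}

/-! ### Coordinates and Lebesgue measure on the plane. -/

theorem measurable_coord (i : Fin 2) : Measurable fun z : Plane => z i :=
  (EuclideanSpace.proj (𝕜 := ℝ) i).continuous.measurable

theorem continuous_coord (i : Fin 2) : Continuous fun z : Plane => z i :=
  (EuclideanSpace.proj (𝕜 := ℝ) i).continuous

/-- The identification of the plane with `ℝ × ℝ`. -/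
def planeEquivProd : Plane ≃ᵐ ℝ × ℝ :=
  (MeasurableEquiv.toLp 2 (Fin 2 → ℝ)).symm.trans MeasurableEquiv.finTwoArrow

theorem measurePreserving_planeEquivProd : MeasurePreserving planeEquivProd :=
  (volume_preserving_finTwoArrow ℝ).comp
    (EuclideanSpace.volume_preserving_symm_measurableEquiv_toLp (Fin 2))

theorem volume_coord_box (s t : Set ℝ) :
    volume {z : Plane | z 0 ∈ s ∧ z 1 ∈ t} = volume s * volume t := by
  have := measurePreserving_planeEquivProd.measure_preimage_equiv (s ×ˢ t)
  rw [Measure.volume_eq_prod, Measure.prod_prod] at this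
  exact this

theorem volume_horizontal_line (t : ℝ) : volume {z : Plane | z 1 = t} = 0 := by
  simpa using volume_coord_box univ {t}

theorem setIntegral_strip_eq (t : ℝ) (g : Plane → ℝ) :
    ∫ z in strip t, g z = ∫ p in (univ : Set ℝ) ×ˢ Ioo 0 t, g !₂[p.1, p.2] := by
  rw [← measurePreserving_planeEquivProd.symm.setIntegral_preimage_emb
    planeEquivProd.symm.measurableEmbedding]
  have hs : (planeEquivProd.symm ⁻¹' strip t) = (univ : Set ℝ) ×ˢ Ioo 0 t := by
    ext p
    exact (and_iff_right (mem_univ p.1)).symm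
  rw [hs]
  refine integral_congr_ae (.of_forall fun p => ?_)
  congr 1

theorem strip_measurable (t : ℝ) : MeasurableSet (strip t) :=
  (measurableSet_lt measurable_const (measurable_coord 1)).inter
    (measurableSet_lt (measurable_coord 1) measurable_const)

/-! ### Integration by parts on a horizontal strip. -/

section Derivatives

variable {φ : Plane → ℝ}

theorem continuous_pderiv (hφ : ContDiff ℝ ∞ φ) (j : Fin 2) : Continuous (pderiv j φ) :=
  (hφ.continuous_fderiv (by simp)).clm_apply continuous_const

theorem hasCompactSupport_pderiv (hc : HasCompactSupport φ) (j : Fin 2) :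
    HasCompactSupport (pderiv j φ) := hc.fderiv_apply ℝ _

theorem isClosedEmbedding_vec :
    Topology.IsClosedEmbedding fun p : ℝ × ℝ => (!₂[p.1, p.2] : Plane) :=
  Function.LeftInverse.isClosedEmbedding (f := fun z : Plane => (z 0, z 1)) (fun p => by simp)
    ((continuous_coord 0).prodMk (continuous_coord 1)) (by fun_prop)

theorem isClosedEmbedding_vec_right (x : ℝ) :
    Topology.IsClosedEmbedding fun y : ℝ => (!₂[x, y] : Plane) :=
  Function.LeftInverse.isClosedEmbedding (f := fun z : Plane => z 1) (fun p => by simp)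
    (continuous_coord 1) (by fun_prop)

theorem isClosedEmbedding_vec_left (y : ℝ) :
    Topology.IsClosedEmbedding fun x : ℝ => (!₂[x, y] : Plane) :=
  Function.LeftInverse.isClosedEmbedding (f := fun z : Plane => z 0) (fun p => by simp)
    (continuous_coord 0) (by fun_prop)

theorem hasDerivAt_vec_left (hφ : ContDiff ℝ ∞ φ) (x y : ℝ) :
    HasDerivAt (fun x => φ !₂[x, y]) (pderiv 0 φ !₂[x, y]) x := by
  have h1 : HasDerivAt (fun x : ℝ => (!₂[0, y] : Plane) + x • basisVec 0) (basisVec 0) x := by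
    simpa using ((hasDerivAt_id x).smul_const (basisVec 0)).const_add (!₂[0, y] : Plane)
  have h2 : ∀ x : ℝ, (!₂[0, y] : Plane) + x • basisVec 0 = !₂[x, y] := by
    intro x; ext i; fin_cases i <;> simp [basisVec]
  simp only [h2] at h1
  exact (hφ.differentiable (by simp) _).hasFDerivAt.comp_hasDerivAt x h1

theorem hasDerivAt_vec_right (hφ : ContDiff ℝ ∞ φ) (x y : ℝ) :
    HasDerivAt (fun y => φ !₂[x, y]) (pderiv 1 φ !₂[x, y]) y := by
  have h1 : HasDerivAt (fun y : ℝ => (!₂[x, 0] : Plane) + y • basisVec 1) (basisVec 1) y := by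
    simpa using ((hasDerivAt_id y).smul_const (basisVec 1)).const_add (!₂[x, 0] : Plane)
  have h2 : ∀ y : ℝ, (!₂[x, 0] : Plane) + y • basisVec 1 = !₂[x, y] := by
    intro y; ext i; fin_cases i <;> simp [basisVec]
  simp only [h2] at h1
  exact (hφ.differentiable (by simp) _).hasFDerivAt.comp_hasDerivAt y h1

theorem integrable_comp_vec {g : Plane → ℝ} (hg : Continuous g) (hc : HasCompactSupport g) :
    Integrable fun p : ℝ × ℝ => g !₂[p.1, p.2] :=
  (hg.comp isClosedEmbedding_vec.continuous).integrable_of_hasCompactSupport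
    (hc.comp_isClosedEmbedding isClosedEmbedding_vec)

theorem integrable_comp_vec_left {g : Plane → ℝ} (hg : Continuous g) (hc : HasCompactSupport g)
    (y : ℝ) : Integrable fun x : ℝ => g !₂[x, y] :=
  (hg.comp (isClosedEmbedding_vec_left y).continuous).integrable_of_hasCompactSupport
    (hc.comp_isClosedEmbedding (isClosedEmbedding_vec_left y))

theorem integral_strip_pderiv_zero (hφ : ContDiff ℝ ∞ φ) (hc : HasCompactSupport φ) (t : ℝ) :
    ∫ z in strip t, pderiv 0 φ z = 0 := by
  have hi := integrable_comp_vec (continuous_pderiv hφ 0) (hasCompactSupport_pderiv hc 0)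
  rw [setIntegral_strip_eq, Measure.volume_eq_prod, ← Measure.prod_restrict,
    integral_prod_symm _ (by
      rw [Measure.prod_restrict]; exact hi.integrableOn)]
  rw [Measure.restrict_univ]
  refine integral_eq_zero_of_ae (.of_forall fun y => ?_)
  exact integral_eq_zero_of_hasDerivAt_of_integrable (fun x => hasDerivAt_vec_left hφ x y)
    (integrable_comp_vec_left (continuous_pderiv hφ 0) (hasCompactSupport_pderiv hc 0) y)
    (integrable_comp_vec_left hφ.continuous hc y)

/-- Fubini and the fundamental theorem of calculus on vertical segments. The two boundary terms are
what carries the trace from height `t` to height `0`. -/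
theorem integral_strip_pderiv_one (hφ : ContDiff ℝ ∞ φ) (hc : HasCompactSupport φ) {t : ℝ}
    (ht : 0 ≤ t) :
    ∫ z in strip t, pderiv 1 φ z = (∫ x : ℝ, φ !₂[x, t]) - ∫ x : ℝ, φ !₂[x, 0] := by
  have hi := integrable_comp_vec (continuous_pderiv hφ 1) (hasCompactSupport_pderiv hc 1)
  rw [setIntegral_strip_eq, Measure.volume_eq_prod, setIntegral_prod _ hi.integrableOn,
    Measure.restrict_univ, ← integral_sub (integrable_comp_vec_left hφ.continuous hc t)
      (integrable_comp_vec_left hφ.continuous hc 0)]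
  refine integral_congr_ae (.of_forall fun x => ?_)
  dsimp only
  rw [← integral_Ioc_eq_integral_Ioo, ← intervalIntegral.integral_of_le ht]
  refine intervalIntegral.integral_eq_sub_of_hasDerivAt
    (fun y _ => hasDerivAt_vec_right hφ x y) ?_
  exact ((continuous_pderiv hφ 1).comp
    (isClosedEmbedding_vec_right x).continuous).intervalIntegrable _ _

theorem pderiv_comp_add (j : Fin 2) (v z : Plane) :
    pderiv j (fun z => φ (z + v)) z = pderiv j φ (z + v) := by
  simp only [pderiv, fderiv_comp_add_right]

end Derivatives

/-! ### Vertical translation of profiles, films and interfaces. -/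

section Raising

variable {ell : ℝ} {h : ℝ → ℝ} {t : ℝ}

theorem film_eq_inter (ell : ℝ) (h : ℝ → ℝ) :
    film ell h = {z | z 0 ∈ Ico 0 ell} ∩ filmPer h := rfl

theorem filmPer_measurable (hm : Measurable h) : MeasurableSet (filmPer h) :=
  (measurableSet_lt measurable_const (measurable_coord 1)).inter
    (measurableSet_lt (measurable_coord 1) (hm.comp (measurable_coord 0)))

theorem column_measurable (ell : ℝ) : MeasurableSet {z : Plane | z 0 ∈ Ico 0 ell} :=
  measurable_coord 0 measurableSet_Ico

theorem mem_filmPer_raise_iff {z : Plane} :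
    z - vert t ∈ filmPer h ↔ t < z 1 ∧ z 1 < h (z 0) + t := by
  simp [filmPer, sub_lt_iff_lt_add]

/-- Only up to a null set: points on the line `y = t` lie in neither piece on the right, but may lie
in the raised film. -/
theorem filmPer_raise_ae (h0 : ∀ x, 0 ≤ h x) (ht : 0 ≤ t) :
    filmPer (fun x => h x + t) =ᵐ[volume] (strip t ∪ (· - vert t) ⁻¹' filmPer h : Set Plane) := by
  have hnull : ∀ᵐ z : Plane, z 1 ≠ t := by
    rw [ae_iff]; simpa using volume_horizontal_line t
  filter_upwards [hnull] with z hz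
  refine propext ?_
  change (0 < z 1 ∧ z 1 < h (z 0) + t) ↔ (0 < z 1 ∧ z 1 < t) ∨ z - vert t ∈ filmPer h
  rw [mem_filmPer_raise_iff]
  have := h0 (z 0)
  constructor
  · rintro ⟨h1, h2⟩
    rcases lt_or_gt_of_ne hz with h3 | h3
    · exact .inl ⟨h1, h3⟩
    · exact .inr ⟨h3, h2⟩
  · rintro (⟨h1, h2⟩ | ⟨h1, h2⟩)
    · exact ⟨h1, by linarith⟩
    · exact ⟨by linarith, h2⟩

theorem film_raise_ae (h0 : ∀ x, 0 ≤ h x) (ht : 0 ≤ t) :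
    film ell (fun x => h x + t) =ᵐ[volume]
      ({z | z 0 ∈ Ico 0 ell} ∩ strip t ∪ (· - vert t) ⁻¹' film ell h : Set Plane) := by
  have h1 := (ae_eq_refl ({z : Plane | z 0 ∈ Ico 0 ell})).inter (filmPer_raise_ae h0 ht)
  rw [inter_union_distrib_left] at h1
  have e : (· - vert t) ⁻¹' film ell h
      = {z : Plane | z 0 ∈ Ico 0 ell} ∩ (· - vert t) ⁻¹' filmPer h := by
    ext z
    simp [film_eq_inter]
  rw [e]
  exact h1

theorem disjoint_strip_filmPer : Disjoint (strip t) ((· - vert t) ⁻¹' filmPer h) := by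
  rw [Set.disjoint_left]
  intro z hz hz'
  have h1 := (mem_filmPer_raise_iff.1 (show z - vert t ∈ filmPer h from hz')).1
  exact absurd hz.2 (not_lt.2 h1.le)

theorem measurePreserving_sub_vert (t : ℝ) :
    MeasurePreserving (fun z : Plane => z - vert t) := measurePreserving_sub_right volume _

theorem measurableEmbedding_sub_vert (t : ℝ) :
    MeasurableEmbedding (fun z : Plane => z - vert t) :=
  (Homeomorph.subRight (vert t)).measurableEmbedding

theorem setIntegral_filmPer_raise (hm : Measurable h) (h0 : ∀ x, 0 ≤ h x) (ht : 0 ≤ t)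
    {g : Plane → ℝ} (hg1 : IntegrableOn g (strip t))
    (hg2 : IntegrableOn (fun z => g (z + vert t)) (filmPer h)) :
    ∫ z in filmPer (fun x => h x + t), g z
      = (∫ z in strip t, g z) + ∫ z in filmPer h, g (z + vert t) := by
  have e := (measurePreserving_sub_vert t).setIntegral_preimage_emb
    (measurableEmbedding_sub_vert t) (fun z => g (z + vert t)) (filmPer h)
  have e2 := ((measurePreserving_sub_vert t).integrableOn_comp_preimage
    (measurableEmbedding_sub_vert t) (f := fun z => g (z + vert t)) (s := filmPer h)).2 hg2
  simp only [Function.comp_def, sub_add_cancel] at e e2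
  rw [setIntegral_congr_set (filmPer_raise_ae h0 ht),
    setIntegral_union disjoint_strip_filmPer
      ((filmPer_measurable hm).preimage (measurable_sub_const _)) hg1 e2, e]

theorem setLIntegral_film_raise (hm : Measurable h) (h0 : ∀ x, 0 ≤ h x) (ht : 0 ≤ t)
    (g : Plane → ENNReal) :
    ∫⁻ z in film ell (fun x => h x + t), g z
      = (∫⁻ z in {z | z 0 ∈ Ico 0 ell} ∩ strip t, g z) + ∫⁻ z in film ell h, g (z + vert t) := by
  have e := (measurePreserving_sub_vert t).setLIntegral_comp_preimage_emb
    (measurableEmbedding_sub_vert t) (fun z => g (z + vert t)) (film ell h)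
  simp only [sub_add_cancel] at e
  rw [setLIntegral_congr (film_raise_ae h0 ht), lintegral_union _ _, e]
  · exact ((column_measurable ell).inter (filmPer_measurable hm)).preimage (measurable_sub_const _)
  · exact (disjoint_strip_filmPer (h := h)).mono inter_subset_right fun z hz => hz.2

theorem volume_column_strip (hell : 0 ≤ ell) (t : ℝ) :
    volume ({z : Plane | z 0 ∈ Ico 0 ell} ∩ strip t) = ENNReal.ofReal (ell * t) := by
  have := volume_coord_box (Ico 0 ell) (Ioo 0 t)
  rw [Real.volume_Ico, Real.volume_Ioo, sub_zero, sub_zero, ← ENNReal.ofReal_mul hell] at this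
  exact this

theorem volume_film_raise (hm : Measurable h) (h0 : ∀ x, 0 ≤ h x) (hell : 0 ≤ ell) (ht : 0 ≤ t) :
    volume (film ell (fun x => h x + t)) = ENNReal.ofReal (ell * t) + volume (film ell h) := by
  rw [← volume_column_strip hell t]
  simpa only [setLIntegral_one] using setLIntegral_film_raise (ell := ell) hm h0 ht fun _ => 1

theorem IsProfile.raise (hp : IsProfile ell h) (ht : 0 ≤ t) : IsProfile ell fun x => h x + t where
  nonneg x := add_nonneg (hp.nonneg x) ht
  lsc := hp.lsc.add continuous_const.lowerSemicontinuous
  periodic x := by simp [hp.periodic x]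
  bddVar := by
    have := hp.bddVar
    simpa [BoundedVariationOn, eVariationOn] using this

theorem IsProfile.measurable (hp : IsProfile ell h) : Measurable h := hp.lsc.measurable

theorem IsProfile.exists_bound (hp : IsProfile ell h) :
    ∃ C, ∀ x ∈ Ico 0 ell, h x ≤ C := by
  -- The variation is taken on the open interval and does not see the value at `0`, which enters
  -- separately; `ell / 2` is an arbitrary interior reference point.
  refine ⟨max (h 0) (h (ell / 2) + (eVariationOn h (Ioo 0 ell)).toReal), fun x hx => ?_⟩
  rcases hx.1.eq_or_lt with rfl | h1
  · exact le_max_left _ _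
  · refine le_max_of_le_right ?_
    have := hp.bddVar.dist_le (x := x) (y := ell / 2) ⟨h1, hx.2⟩
      ⟨by linarith [hx.2], by linarith [hx.2]⟩
    rw [Real.dist_eq] at this
    linarith [le_abs_self (h x - h (ell / 2))]

theorem IsProfile.film_subset_compact (hp : IsProfile ell h) :
    ∃ K, IsCompact K ∧ film ell h ⊆ K := by
  obtain ⟨C, hC⟩ := hp.exists_bound
  refine ⟨_, ((isCompact_Icc (a := (0 : ℝ)) (b := ell)).prod
    (isCompact_Icc (a := (0 : ℝ)) (b := C))).image isClosedEmbedding_vec.continuous, ?_⟩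
  intro z hz
  refine ⟨(z 0, z 1), ⟨⟨hz.1.1, hz.1.2.le⟩, hz.2.1.le, hz.2.2.le.trans (hC _ hz.1)⟩, ?_⟩
  ext i; fin_cases i <;> simp

/-- No existence of the limit is needed, since the default value `f a` shifts by `c` as well. A
general linear order is allowed so that right limits follow by passing to the order dual. -/
theorem leftLim_add_const {α : Type*} [LinearOrder α] (f : α → ℝ) (c : ℝ) (a : α) :
    Function.leftLim (fun x => f x + c) a = Function.leftLim f a + c := by
  let _ : TopologicalSpace α := Preorder.topology α
  have : OrderTopology α := ⟨rfl⟩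
  rcases Filter.eq_or_neBot (nhdsWithin a (Iio a)) with hb | hb
  · rw [leftLim_eq_of_eq_bot _ hb, leftLim_eq_of_eq_bot _ hb]
  by_cases hl : ∃ y, Filter.Tendsto f (nhdsWithin a (Iio a)) (nhds y)
  · obtain ⟨y, hy⟩ := hl
    rw [leftLim_eq_of_tendsto hy, leftLim_eq_of_tendsto (hy.add_const c)]
  · rw [leftLim_eq_of_not_tendsto _ hl, leftLim_eq_of_not_tendsto]
    rintro ⟨y, hy⟩
    exact hl ⟨y - c, by simpa using hy.sub_const c⟩

theorem rightLim_add_const (f : ℝ → ℝ) (c a : ℝ) :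
    Function.rightLim (fun x => f x + c) a = Function.rightLim f a + c :=
  leftLim_add_const (α := ℝᵒᵈ) f c a

theorem upperLim_raise (x : ℝ) : upperLim (fun x => h x + t) x = upperLim h x + t := by
  simp only [upperLim, leftLim_add_const, rightLim_add_const, max_add_add_right]

theorem lowerLim_raise (x : ℝ) : lowerLim (fun x => h x + t) x = lowerLim h x + t := by
  simp only [lowerLim, leftLim_add_const, rightLim_add_const, min_add_add_right]

theorem graphSet_raise : graphSet ell (fun x => h x + t) = (· + vert t) '' graphSet ell h := by
  rw [image_add_right]
  ext z
  simp [graphSet, lowerLim_raise, upperLim_raise, ← sub_eq_add_neg, le_sub_iff_add_le]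

theorem crackSet_raise : crackSet ell (fun x => h x + t) = (· + vert t) '' crackSet ell h := by
  rw [image_add_right]
  ext z
  simp [crackSet, lowerLim_raise, ← sub_eq_add_neg, le_sub_iff_add_le]

theorem hausdorffMeasure_image_add_vert (S : Set Plane) :
    Measure.hausdorffMeasure 1 ((· + vert t) '' S) = Measure.hausdorffMeasure 1 S :=
  (IsometryEquiv.addRight (vert t)).hausdorffMeasure_image 1 S

end Raising

/-! ### Mollified dislocation measures. -/

section Dislocations

variable (P : FilmData)

theorem norm_lt_of_mollifier_ne_zero {z : Plane} (hz : P.mollifier z ≠ 0) : ‖z‖ < P.r0 := by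
  have h1 : P.r0⁻¹ • z ∈ tsupport P.rho := subset_tsupport _ (right_ne_zero_of_mul hz)
  have h2 := P.rho_support h1
  rw [mem_ball_zero_iff, norm_smul, norm_inv, Real.norm_of_nonneg P.r0_pos.le,
    inv_mul_lt_iff₀ P.r0_pos, mul_one] at h2
  exact h2

theorem continuous_mollifier : Continuous P.mollifier :=
  continuous_const.mul (P.rho_smooth.continuous.comp (continuous_const_smul _))

theorem convMollifier_dislocationMeasure {k : ℕ} (b z : Fin k → Plane) (w : Plane) :
    convMollifier P (dislocationMeasure P.ell_pos b z) w
      = ∑ i, (∑ᶠ m : ℤ, P.mollifier (w - (z i + ((m : ℝ) * P.ell) • basisVec 0))) • b i := by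
  simp only [convMollifier, dislocationMeasure, LinearMap.sum_apply, LinearMap.smulRight_apply]
  rfl

theorem continuous_convMollifier_dislocationMeasure {k : ℕ} (b z : Fin k → Plane) :
    Continuous (convMollifier P (dislocationMeasure P.ell_pos b z)) := by
  have he : convMollifier P (dislocationMeasure P.ell_pos b z) = fun w =>
      ∑ i, (∑ᶠ m : ℤ, P.mollifier (w - (z i + ((m : ℝ) * P.ell) • basisVec 0))) • b i :=
    funext (convMollifier_dislocationMeasure P b z)
  rw [he]
  refine continuous_finsetSum _ fun i _ => ?_
  suffices hi : Continuous fun w =>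
      ∑ᶠ m : ℤ, P.mollifier (w - (z i + ((m : ℝ) * P.ell) • basisVec 0)) from hi.smul continuous_const
  refine continuous_finsum
    (fun m => (continuous_mollifier P).comp (continuous_id.sub continuous_const)) fun w => ?_
  refine ⟨Metric.ball w 1, Metric.ball_mem_nhds w one_pos, ?_⟩
  -- If the `m`-th term is nonzero at some `v` with `‖v - w‖ < 1`, the triangle inequality gives
  -- `|m| ℓ ≤ ‖w - z i‖ + 1 + r₀`; the periodic sum is thus locally finite.
  set R := (‖w - z i‖ + 1 + P.r0) / P.ell with hR
  refine (Set.finite_Icc (-⌈R⌉) ⌈R⌉).subset ?_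
  rintro m ⟨v, hv, hvw⟩
  have h1 := norm_lt_of_mollifier_ne_zero P hv
  rw [mem_ball_iff_norm] at hvw
  have h2 : ‖((m : ℝ) * P.ell) • basisVec 0‖ = |(m : ℝ)| * P.ell := by
    simp [basisVec, norm_smul, abs_of_pos P.ell_pos]
  have h3 : |(m : ℝ)| ≤ R := by
    rw [hR, le_div_iff₀ P.ell_pos, ← h2]
    calc ‖((m : ℝ) * P.ell) • basisVec 0‖
        = ‖(w - z i) + (v - w) - (v - (z i + ((m : ℝ) * P.ell) • basisVec 0))‖ := by
          congr 1; abel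
      _ ≤ ‖w - z i‖ + ‖v - w‖ + ‖v - (z i + ((m : ℝ) * P.ell) • basisVec 0)‖ :=
          (norm_sub_le _ _).trans (add_le_add_left (norm_add_le _ _) _)
      _ ≤ _ := by linarith
  have h5 := abs_le.1 (h3.trans (Int.le_ceil R))
  exact ⟨by exact_mod_cast h5.1, by exact_mod_cast h5.2⟩

theorem convMollifier_add_vert {k : ℕ} (b z : Fin k → Plane) (t : ℝ) (w : Plane) :
    convMollifier P (dislocationMeasure P.ell_pos b fun i => z i + vert t) (w + vert t)
      = convMollifier P (dislocationMeasure P.ell_pos b z) w := by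
  simp only [convMollifier_dislocationMeasure]
  refine Finset.sum_congr rfl fun i _ => ?_
  congr 2
  funext m
  congr 1
  abel

/-- The cores lie in `y > 0`, and horizontal periodic translation preserves the ordinate. After
lifting, this says that the inserted slab carries no dislocation density, as its constant strain
requires. -/
theorem convMollifier_eq_zero_of_nonpos {h : ℝ → ℝ} {k : ℕ} (b : Fin k → Plane) {z : Fin k → Plane}
    (hz : ∀ i, Metric.ball (z i) P.r0 ⊆ filmPer h) {w : Plane} (hw : w 1 ≤ 0) :
    convMollifier P (dislocationMeasure P.ell_pos b z) w = 0 := by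
  rw [convMollifier_dislocationMeasure]
  refine Finset.sum_eq_zero fun i _ => ?_
  rw [finsum_eq_zero_of_forall_eq_zero, zero_smul]
  intro m
  by_contra hne
  have h1 := norm_lt_of_mollifier_ne_zero P hne
  have h2 : w - ((m : ℝ) * P.ell) • basisVec 0 ∈ Metric.ball (z i) P.r0 := by
    rw [mem_ball_iff_norm]
    rwa [sub_right_comm, sub_sub]
  have h3 := (hz i h2).1
  simp [basisVec] at h3
  linarith

end Dislocations

/-! ### Gluing a constant strain under the lifted field. -/

section Strain

variable {ell : ℝ} {h : ℝ → ℝ} {t : ℝ}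

/-- The field equal to the constant `A` below height `t` and to the translate of `H` above. -/
def raiseField (t : ℝ) (A : Mat) (H : Plane → Mat) (z : Plane) : Mat :=
  if z 1 < t then A else H (z - vert t)

theorem periodicExt_raiseField (ell : ℝ) (t : ℝ) (A : Mat) (H : Plane → Mat) :
    periodicExt ell (raiseField t A H) = raiseField t A (periodicExt ell H) := by
  funext z
  simp only [periodicExt, raiseField]
  have h1 : (z - ((⌊z 0 / ell⌋ : ℝ) * ell) • basisVec 0) 1 = z 1 := by simp [basisVec]
  have h2 : (z - vert t) 0 = z 0 := by simp
  rw [h1, h2, sub_right_comm]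

theorem raiseField_add_vert {A : Mat} {H : Plane → Mat} {z : Plane} (hz : 0 ≤ z 1) :
    raiseField t A H (z + vert t) = H z := by
  have : ¬ (z + vert t) 1 < t := by simpa using hz
  rw [raiseField, if_neg this, add_sub_cancel_right]

/-- The compact set is cut at `y = t`. Its upper part, shifted down, may touch `y = 0`, so
integrability of `H` up to the base is essential; on the lower part the field is constant. -/
theorem memLp_raiseField {A : Mat} {H : Plane → Mat} {i j : Fin 2}
    (hH : ∀ K, IsCompact K → K ⊆ filmBase h → MemLp (fun z => H z i j) 2 (volume.restrict K))
    {K : Set Plane} (hK : IsCompact K) (hKh : K ⊆ filmBase fun x => h x + t) :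
    MemLp (fun z => raiseField t A H z i j) 2 (volume.restrict K) := by
  have hup : IsClosed {z : Plane | t ≤ z 1} := isClosed_le continuous_const (continuous_coord 1)
  have hKm : MeasurableSet K := hK.measurableSet
  have hKt : IsCompact (K ∩ {z : Plane | t ≤ z 1}) := hK.inter_right hup
  have hm1 : MemLp (fun z => raiseField t A H z i j) 2
      (volume.restrict (K ∩ {z : Plane | t ≤ z 1})) := by
    have hK' : IsCompact ((· + vert t) ⁻¹' (K ∩ {z : Plane | t ≤ z 1})) :=
      (Homeomorph.addRight (vert t)).isCompact_preimage.2 hKt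
    have h1 := hH _ hK' (fun z hz => by
      have hz1 : t ≤ (z + vert t) 1 := hz.2
      have hz2 := (hKh hz.1).2
      simp at hz1 hz2
      exact ⟨hz1, hz2⟩)
    have h2 := h1.comp_measurePreserving ((measurePreserving_sub_vert t).restrict_preimage_emb
      (measurableEmbedding_sub_vert t) _)
    rw [← preimage_comp] at h2
    simp only [Function.comp_def, sub_add_cancel, preimage_id'] at h2
    refine (memLp_congr_ae ?_).1 h2
    filter_upwards [ae_restrict_mem hKt.measurableSet] with z hz
    rw [raiseField, if_neg (not_lt.2 hz.2)]
  have hm2 : MemLp (fun z => raiseField t A H z i j) 2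
      (volume.restrict (K \ {z : Plane | t ≤ z 1})) := by
    have : IsFiniteMeasure (volume.restrict (K \ {z : Plane | t ≤ z 1})) :=
      isFiniteMeasure_restrict.2 ((measure_mono sdiff_subset).trans_lt hK.measure_lt_top).ne
    refine (memLp_congr_ae ?_).1 (memLp_const (A i j))
    filter_upwards [ae_restrict_mem (hKm.diff hup.measurableSet)] with z hz
    rw [raiseField, if_pos (not_le.1 hz.2)]
  rw [inter_comm, ← Measure.restrict_restrict hup.measurableSet] at hm1
  rw [sdiff_eq_compl_inter, ← Measure.restrict_restrict hup.measurableSet.compl] at hm2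
  classical
  simpa using MemLp.piecewise hup.measurableSet hm1 hm2

theorem MemHcurl.of_continuous {H : Plane → Mat} {f : Plane → Plane} (hp : IsProfile ell h)
    (hH : ∀ K, IsCompact K → K ⊆ filmBase h → ∀ i j,
      MemLp (fun z => periodicExt ell H z i j) 2 (volume.restrict K))
    (hf : Continuous f) (hcurl : HasWeakCurl (filmPer h) (periodicExt ell H) f) :
    MemHcurl ell h H := by
  have hfK : ∀ K, IsCompact K → MemLp f 2 (volume.restrict K) := fun K hK => by
    have : IsFiniteMeasure (volume.restrict K) := isFiniteMeasure_restrict.2 hK.measure_lt_top.ne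
    obtain ⟨C, hC⟩ := hK.exists_bound_of_continuousOn hf.continuousOn
    refine MemLp.of_bound hf.aestronglyMeasurable C ?_
    filter_upwards [ae_restrict_mem hK.measurableSet] with z hz using hC z hz
  obtain ⟨K, hK, hKf⟩ := hp.film_subset_compact
  exact ⟨hH, f, hcurl, (hfK K hK).mono_measure (Measure.restrict_mono hKf le_rfl),
    fun K hK _ => hfK K hK⟩

/-- Test functions supported in the open film vanish on `y = 0`, so Green's formula loses its
boundary term. -/
theorem HasTangentialTrace.hasWeakCurl {H : Plane → Mat} {f : Plane → Plane} {v : Plane}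
    (htr : HasTangentialTrace h H f v) : HasWeakCurl (filmPer h) H f := by
  rintro φ ⟨hs, hc, hsub⟩ i
  have h0 : ∀ x : ℝ, φ !₂[x, 0] = 0 := fun x => by
    refine image_eq_zero_of_notMem_tsupport fun hx => ?_
    have := (hsub hx).1
    simp at this
  have := htr φ ⟨hs, hc, hsub.trans fun z hz => hz.2⟩ i
  simpa [h0] using this

theorem integrableOn_field_mul {H : Plane → Mat} {i j : Fin 2} (hm : Measurable h)
    (hH : ∀ K, IsCompact K → K ⊆ filmBase h → MemLp (fun z => H z i j) 2 (volume.restrict K))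
    {ψ : Plane → ℝ} (hψ : Continuous ψ) (hc : HasCompactSupport ψ) (hs : tsupport ψ ⊆ subgraph h) :
    IntegrableOn (fun z => H z i j * ψ z) (filmPer h) := by
  have hup : IsClosed {z : Plane | 0 ≤ z 1} := isClosed_le continuous_const (continuous_coord 1)
  have hK : IsCompact (tsupport ψ ∩ {z : Plane | 0 ≤ z 1}) :=
    (show IsCompact (tsupport ψ) from hc).inter_right hup
  have h1 := hH _ hK fun z hz => ⟨hz.2, hs hz.1⟩
  have h2 : MemLp ψ 2 (volume.restrict (tsupport ψ ∩ {z : Plane | 0 ≤ z 1})) :=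
    (hψ.memLp_of_hasCompactSupport hc).restrict _
  have h3 : IntegrableOn (fun z => H z i j * ψ z) (tsupport ψ ∩ {z : Plane | 0 ≤ z 1}) :=
    h1.integrable_mul h2
  refine h3.of_forall_sdiff_eq_zero (filmPer_measurable hm) fun z hz => ?_
  have : z ∉ tsupport ψ := fun hz' => hz.2 ⟨hz', hz.1.1.le⟩
  rw [image_eq_zero_of_notMem_tsupport this, mul_zero]

theorem tsupport_pderiv_subset (φ : Plane → ℝ) (j : Fin 2) :
    tsupport (pderiv j φ) ⊆ tsupport φ := tsupport_fderiv_apply_subset ℝ _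

/-- The slab contributes `v i * (∫ φ(x,t) dx - ∫ φ(x,0) dx)`, and the old trace formula, tested with
`φ` shifted down by `t`, contributes `v i * ∫ φ(x,t) dx` with the opposite sign. The terms at `y =
t` cancel. The second column of `A` plays no role, because `∂ₓφ` integrates to zero on the strip. -/
theorem HasTangentialTrace.raise {A : Mat} {H : Plane → Mat} {f g : Plane → Plane} {v : Plane}
    (hp : IsProfile ell h) (ht : 0 ≤ t)
    (hH : ∀ K, IsCompact K → K ⊆ filmBase h → ∀ i j,
      MemLp (fun z => H z i j) 2 (volume.restrict K))
    (hA : ∀ i, A i 0 = v i) (hg : Continuous g) (hgf : ∀ z, g (z + vert t) = f z)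
    (hf0 : ∀ z : Plane, z 1 ≤ 0 → f z = 0) (htr : HasTangentialTrace h H f v) :
    HasTangentialTrace (fun x => h x + t) (raiseField t A H) g v := by
  rintro φ ⟨hs, hc, hsub⟩ i
  set ψ : Plane → ℝ := fun z => φ (z + vert t) with hψ
  have hψt : tsupport ψ = (· + vert t) ⁻¹' tsupport φ :=
    tsupport_comp_eq_preimage φ (Homeomorph.addRight (vert t))
  have hψs : ContDiff ℝ ∞ ψ := hs.comp (contDiff_id.add contDiff_const)
  have hψc : HasCompactSupport ψ := hc.comp_homeomorph (Homeomorph.addRight (vert t))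
  have hψsub : tsupport ψ ⊆ subgraph h := fun z hz => by
    rw [hψt] at hz
    simpa [subgraph] using hsub hz
  have htrψ := htr ψ ⟨hψs, hψc, hψsub⟩ i
  have hint : ∀ j l, IntegrableOn (fun z => H z i j * pderiv l ψ z) (filmPer h) := fun j l =>
    integrableOn_field_mul hp.measurable (fun K hK hKh => hH K hK hKh i j)
      (continuous_pderiv hψs l) (hasCompactSupport_pderiv hψc l)
      ((tsupport_pderiv_subset ψ l).trans hψsub)
  have hpd : ∀ l, Integrable (pderiv l φ) := fun l =>
    (continuous_pderiv hs l).integrable_of_hasCompactSupport (hasCompactSupport_pderiv hc l)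
  have hfilm : MeasurableSet (filmPer h) := filmPer_measurable hp.measurable
  have hupper : EqOn (fun z => raiseField t A H (z + vert t) i 0 * pderiv 1 φ (z + vert t)
      - raiseField t A H (z + vert t) i 1 * pderiv 0 φ (z + vert t))
      (fun z => H z i 0 * pderiv 1 ψ z - H z i 1 * pderiv 0 ψ z) (filmPer h) := fun z hz => by
    simp only [raiseField_add_vert hz.1.le, hψ, pderiv_comp_add]
  have hlower : EqOn (fun z => raiseField t A H z i 0 * pderiv 1 φ z
      - raiseField t A H z i 1 * pderiv 0 φ z)
      (fun z => A i 0 * pderiv 1 φ z - A i 1 * pderiv 0 φ z) (strip t) := fun z hz => by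
    simp only [raiseField, if_pos hz.2]
  have hgφ : Integrable fun z => g z i * φ z :=
    (((continuous_coord i).comp hg).mul hs.continuous).integrable_of_hasCompactSupport hc.mul_left
  have hg0 : EqOn (fun z => g z i * φ z) 0 (strip t) := fun z hz => by
    have h1 := hgf (z - vert t)
    rw [sub_add_cancel, hf0 _ (by simpa using hz.2.le)] at h1
    simp [h1]
  rw [setIntegral_filmPer_raise hp.measurable hp.nonneg ht
      (((((hpd 1).const_mul (A i 0)).sub ((hpd 0).const_mul (A i 1))).integrableOn).congr_fun
        hlower.symm (strip_measurable t))
      (((hint 0 1).sub (hint 1 0)).congr_fun hupper.symm hfilm),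
    setIntegral_filmPer_raise hp.measurable hp.nonneg ht hgφ.integrableOn
      (hgφ.comp_add_right (vert t)).integrableOn,
    setIntegral_congr_fun hfilm hupper, setIntegral_congr_fun (strip_measurable t) hlower,
    setIntegral_congr_fun (strip_measurable t) hg0,
    integral_sub ((hpd 1).const_mul _).integrableOn ((hpd 0).const_mul _).integrableOn,
    integral_const_mul, integral_const_mul, integral_strip_pderiv_zero hs hc,
    integral_strip_pderiv_one hs hc ht]
  have hψ0 : ∀ x : ℝ, ψ !₂[x, 0] = φ !₂[x, t] := fun x => by
    simp only [hψ]
    congr 1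
    ext j; fin_cases j <;> simp
  simp only [hψ0, integral_const_mul] at htrψ ⊢
  simp only [hgf, hA]
  have h0 : ∫ z in strip t, (0 : Plane → ℝ) z = 0 := by simp
  rw [h0, zero_add, ← htrψ]
  ring

end Strain

/-! ### Admissibility and energy of the lifted configuration. -/

section Configurations

variable (P : FilmData)

/-- The mismatch strain of the flat equilibrium, `e₀ Dv₀`. -/
def FilmData.flatStrain : Mat :=
  P.e0 • jacobian (flatEquilibrium P.mu P.lam) 0

theorem jacobian_flatEquilibrium (mu lam : ℝ) (z : Plane) :
    jacobian (flatEquilibrium mu lam) z = Matrix.of ![![1, 0], ![0, -lam / (2 * mu + lam)]] := by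
  have hlin : ∀ j, HasDerivAt (fun s : ℝ => flatEquilibrium mu lam (z + s • basisVec j))
      (flatEquilibrium mu lam (basisVec j)) 0 := fun j => by
    have h1 : (fun s : ℝ => flatEquilibrium mu lam (z + s • basisVec j)) =
        fun s : ℝ => flatEquilibrium mu lam z + s • flatEquilibrium mu lam (basisVec j) := by
      funext s
      ext i; fin_cases i <;> simp [flatEquilibrium] <;> ring
    rw [h1]
    simpa using ((hasDerivAt_id (0 : ℝ)).smul_const
      (flatEquilibrium mu lam (basisVec j))).const_add (flatEquilibrium mu lam z)
  have hd : Differentiable ℝ (flatEquilibrium mu lam) := by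
    rw [differentiable_euclidean]
    intro i
    have h0 : ∀ j : Fin 2, Differentiable ℝ fun z : Plane => z j := fun j =>
      (EuclideanSpace.proj (𝕜 := ℝ) j).differentiable
    have h00 := h0 0
    have h01 := h0 1
    fin_cases i
    · simpa [flatEquilibrium] using h00
    · exact (h01.const_mul (-lam)).mul_const (2 * mu + lam)⁻¹
  have hval : ∀ j, fderiv ℝ (flatEquilibrium mu lam) z (basisVec j)
      = flatEquilibrium mu lam (basisVec j) := fun j => by
    have h2 : HasDerivAt (fun s : ℝ => z + s • basisVec j) (basisVec j) 0 := by
      simpa using ((hasDerivAt_id (0 : ℝ)).smul_const (basisVec j)).const_add z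
    have h3 : HasFDerivAt (flatEquilibrium mu lam) (fderiv ℝ (flatEquilibrium mu lam) z)
        (z + (0 : ℝ) • basisVec j) := by
      simpa using (hd z).hasFDerivAt
    exact HasDerivAt.unique (h3.comp_hasDerivAt (0 : ℝ) h2) (by exact hlin j)
  ext i j
  simp only [jacobian, Matrix.of_apply, hval]
  fin_cases i <;> fin_cases j <;> simp [flatEquilibrium, basisVec]

theorem flatStrain_apply_zero (i : Fin 2) : P.flatStrain i 0 = (P.e0 • basisVec 0) i := by
  rw [FilmData.flatStrain, jacobian_flatEquilibrium]
  fin_cases i <;> simp [basisVec]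

theorem elasticDensity_smul (mu lam a : ℝ) (E : Mat) :
    elasticDensity mu lam (a • E) = a ^ 2 * elasticDensity mu lam E := by
  simp only [elasticDensity, Matrix.trace_smul, Matrix.smul_apply, smul_eq_mul, mul_pow,
    ← Finset.mul_sum]
  ring

theorem symPart_smul (a : ℝ) (A : Mat) : symPart (a • A) = a • symPart A := by
  rw [symPart, symPart, Matrix.transpose_smul, ← smul_add, smul_comm]

theorem elasticDensity_flatStrain :
    elasticDensity P.mu P.lam (symPart P.flatStrain) = P.e0 ^ 2 * P.W0 := by
  rw [FilmData.flatStrain, symPart_smul, elasticDensity_smul, FilmData.W0]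

/-- The bulk integral splits into slab and translated film, and the interfaces move by an isometry.
The equality holds in `ENNReal`, so it needs neither finite energy nor measurability of `H`; the
measures `σ`, `σ'` are arbitrary because the energy does not depend on them. -/
theorem film_raise_energy {h : ℝ → ℝ} (hp : IsProfile P.ell h) {t : ℝ} (ht : 0 ≤ t)
    (σ σ' : VecMeasure) (H : Plane → Mat) :
    energy P ⟨fun x => h x + t, σ', raiseField t P.flatStrain H⟩
      = energy P ⟨h, σ, H⟩
        + ENNReal.ofReal (P.e0 ^ 2 * P.W0) * ENNReal.ofReal (P.ell * t) := by
  have h1 : ∫⁻ z in {z : Plane | z 0 ∈ Ico 0 P.ell} ∩ strip t, ENNReal.ofReal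
      (elasticDensity P.mu P.lam (symPart (raiseField t P.flatStrain H z)))
      = ENNReal.ofReal (P.e0 ^ 2 * P.W0) * ENNReal.ofReal (P.ell * t) := by
    rw [← volume_column_strip P.ell_pos.le, ← setLIntegral_const, ← elasticDensity_flatStrain]
    refine setLIntegral_congr_fun ((column_measurable _).inter (strip_measurable t))
      fun z hz => ?_
    simp only [raiseField, if_pos hz.2.2]
  have h2 : ∫⁻ z in film P.ell h, ENNReal.ofReal (elasticDensity P.mu P.lam
      (symPart (raiseField t P.flatStrain H (z + vert t))))
      = ∫⁻ z in film P.ell h, ENNReal.ofReal (elasticDensity P.mu P.lam (symPart (H z))) := by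
    refine setLIntegral_congr_fun ((column_measurable _).inter (filmPer_measurable hp.measurable))
      fun z hz => ?_
    simp only [raiseField_add_vert hz.2.1.le]
  simp only [energy, setLIntegral_film_raise hp.measurable hp.nonneg ht, graphSet_raise,
    crackSet_raise, hausdorffMeasure_image_add_vert, h1, h2]
  ring

theorem IsAdmissible.exists_raise {k : ℕ} {b : Fin k → Plane} {c : Config}
    (hc : IsAdmissible P b c) {t : ℝ} (ht : 0 ≤ t) :
    ∃ c', IsAdmissible P b c' ∧ c'.h = (fun x => c.h x + t) ∧
      energy P c' = energy P c
        + ENNReal.ofReal (P.e0 ^ 2 * P.W0) * ENNReal.ofReal (P.ell * t) := by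
  obtain ⟨h, σ, H⟩ := c
  -- The curl equation is dropped: for the lifted field it is recovered from the trace formula.
  obtain ⟨hp, ⟨z, hz, rfl⟩, hH, -, htr⟩ := hc
  have hcont := continuous_convMollifier_dislocationMeasure P b fun i => z i + vert t
  have htr' : HasTangentialTrace (fun x => h x + t)
      (periodicExt P.ell (raiseField t P.flatStrain H))
      (convMollifier P (dislocationMeasure P.ell_pos b fun i => z i + vert t))
      (P.e0 • basisVec 0) := by
    rw [periodicExt_raiseField]
    exact htr.raise hp ht hH.1 (flatStrain_apply_zero P) hcont (convMollifier_add_vert P b z t)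
      fun w hw => convMollifier_eq_zero_of_nonpos P b (fun i => (hz i).2) hw
  refine ⟨⟨fun x => h x + t, dislocationMeasure P.ell_pos b fun i => z i + vert t,
    raiseField t P.flatStrain H⟩, ⟨hp.raise ht, ⟨_, fun i => ⟨?_, fun w hw => ?_⟩, rfl⟩,
    .of_continuous (hp.raise ht) (fun K hK hKh i j => ?_) hcont htr'.hasWeakCurl,
    htr'.hasWeakCurl, htr'⟩, rfl, film_raise_energy P hp ht _ _ H⟩
  · obtain ⟨h1, h2, h3⟩ := (hz i).1
    refine ⟨by simpa using h1, ?_, by simpa using h3⟩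
    simp only [PiLp.add_apply, vert_one_coord]
    linarith
  · have hw' : w - vert t ∈ Metric.ball (z i) P.r0 := by
      rw [mem_ball_iff_norm] at hw ⊢
      convert hw using 2
      abel
    have := mem_filmPer_raise_iff.1 ((hz i).2 hw')
    exact ⟨ht.trans_lt this.1, this.2⟩
  · rw [periodicExt_raiseField]
    exact memLp_raiseField (fun K hK hKh => hH.1 K hK hKh i j) hK hKh

end Configurations

end EpitaxialFilm

end

theorem mainTheorem11 (P : EpitaxialFilm.FilmData) {k : ℕ} (b : Fin k → EpitaxialFilm.Plane)
    (d : ℝ) (hd : 0 < d) (c : EpitaxialFilm.Config)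
    (hc : EpitaxialFilm.IsMinimizer (EpitaxialFilm.classEq P b d) (EpitaxialFilm.energy P) c)
    (Λ : ℝ) (hΛ : P.e0 ^ 2 * P.W0 < Λ) :
    EpitaxialFilm.IsMinimizer (EpitaxialFilm.classLe P b d)
      (EpitaxialFilm.penalizedEnergy P Λ d) c := by
  obtain ⟨⟨hadm, hvol⟩, hmin⟩ := hc
  refine ⟨⟨hadm, hvol.le⟩, ?_⟩
  rintro c' ⟨hadm', hvol'⟩
  set v := volume.real (EpitaxialFilm.film P.ell c'.h) with hv
  have hv0 : 0 ≤ v := measureReal_nonneg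
  have hvol'' : volume (EpitaxialFilm.film P.ell c'.h) = ENNReal.ofReal v :=
    (ENNReal.ofReal_toReal (hvol'.trans_lt ENNReal.ofReal_lt_top).ne).symm
  have hvd : v ≤ d := by rwa [hvol'', ENNReal.ofReal_le_ofReal_iff hd.le] at hvol'
  -- Lifting by this height adds exactly the missing area `d - v` over one period.
  have ht : 0 ≤ (d - v) / P.ell := div_nonneg (sub_nonneg.2 hvd) P.ell_pos.le
  have hlt : P.ell * ((d - v) / P.ell) = d - v := mul_div_cancel₀ _ P.ell_pos.ne'
  obtain ⟨c₁, hadm₁, hh₁, hE₁⟩ := hadm'.exists_raise P ht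
  have hvol₁ : volume (EpitaxialFilm.film P.ell c₁.h) = ENNReal.ofReal d := by
    rw [hh₁, EpitaxialFilm.volume_film_raise hadm'.profile.measurable hadm'.profile.nonneg
      P.ell_pos.le ht, hvol'', hlt, ← ENNReal.ofReal_add (sub_nonneg.2 hvd) hv0, sub_add_cancel]
  have hcE : EpitaxialFilm.penalizedEnergy P Λ d c = EpitaxialFilm.energy P c := by
    simp [EpitaxialFilm.penalizedEnergy, measureReal_def, hvol, ENNReal.toReal_ofReal hd.le]
  rw [hcE]
  refine (hmin c₁ ⟨hadm₁, hvol₁⟩).trans ?_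
  -- Merging the two `ENNReal.ofReal` factors through the sign of `d - v` avoids proving `0 ≤ W₀`.
  rw [hE₁, hlt, EpitaxialFilm.penalizedEnergy, ← hv,
    ← ENNReal.ofReal_mul' (sub_nonneg.2 hvd)]
  gcongr
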